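/- **Setting.** Let $h_1\in\mathbb F_2^{m_1\times n_1}$ and $h_2\in\mathbb F_2^{m_2\times n_2}$ be parity-check matrices. Their hypergraph product (HGP) code is the CSS code on $n_1n_2$ left and $m_1m_2$ right qubits with $$H_X=(h_1\otimes I\mid I\otimes h_2^{T}),\qquad H_Z=(I\otimes h_2\mid h_1^{T}\otimes I).$$ The left-sector HGP code is the CSS subsystem code in which the right-sector logical qubits are gauge qubits. Its $X$-type gauge group is generated by the rows of $H_X$ and the operators $(0\mid a\otimes b)$ with $h_1^{T}a=0$. Its $Z$-type gauge group is generated by the rows of $H_Z$ and the operators $(0\mid a\otimes b)$ with $h_2^{T}b=0$. A nontrivial dressed logical operator is a Pauli operator that commutes with all stabilizers and is not a gauge operator (up to phase). The code distance $d$ is the least weight of such an operator ($d=\infty$ if there is none). **Gadgets.** For permutation matrices $\sigma_i$ and invertible matrices $w_i$ with $h_i\sigma_i=w_ih_i$, the automorphism gadgets are the Clifford operations $$U_1=(\sigma_1\otimes I)\oplus(w_1\otimes I),\qquad U_2=(I\otimes\sigma_2)\oplus(I\otimes w_2^{-T}),$$ which map $X$-supports by $x\mapsto xU$ and $Z$-supports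 by $z\mapsto zU^{-T}$ (row vectors). **Circuits and faults.** A gadget is implemented by a finite sequence of time steps. Each step consists of a physical permutation of the left qubits and of the right qubits, followed by a layer of Clifford gates with disjoint supports on the right qubits; all other qubits idle. Every qubit also idles once before the first step. Physical permutations neither fail nor spread errors. An elementary fault is the failure of one gate or of one idling qubit; it leaves an arbitrary Pauli error on the support of that gate, or on that qubit, which then propagates through the rest of the circuit. The effective fault distance $d_{\rm eff}$ of the circuit is the least number of elementary faults whose total residual error after the circuit is a nontrivial dressed logical operator ($\infty$ if there are none). **Theorem.** If $\ker h_1\neq 0$ and $\ker h_2\ne 0$, then $d=\min(d_1,d_2)$, where $d_i$ is the minimum distance of the classical code $\ker h_i$. For every automorphism gadget $U_1$ or $U_2$ and every circuit of the above form implementing it, $d_{\rm eff}=d$. In particular, at least $d$ elementary faults are needed to cause a nontrivial logical error. -/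

import Mathlib

open scoped Kronecker

namespace LeftHGP

/-- An `n`-qubit Pauli operator up to phase: its `X`-support and its `Z`-support. -/
abbrev Pauli (Q : Type) : Type := (Q → ZMod 2) × (Q → ZMod 2)

/-- The qubits on which a Pauli operator acts nontrivially. -/
def Pauli.supp {Q : Type} (E : Pauli Q) : Set Q := {q | E.1 q ≠ 0 ∨ E.2 q ≠ 0}

/-- The weight of a Pauli operator (a `Y` counts once). -/
noncomputable def Pauli.weight {Q : Type} (E : Pauli Q) : ℕ := E.supp.ncard

/-- The symplectic form: `0` if the two Pauli operators commute, `1` if they anticommute. -/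
def Pauli.symp {Q : Type} [Fintype Q] (E E' : Pauli Q) : ZMod 2 := E.1 ⬝ᵥ E'.2 + E.2 ⬝ᵥ E'.1

/-- Left data qubits of the hypergraph product. -/
abbrev LeftQ (n₁ n₂ : ℕ) : Type := Fin n₁ × Fin n₂

/-- Right data qubits of the hypergraph product. -/
abbrev RightQ (m₁ m₂ : ℕ) : Type := Fin m₁ × Fin m₂

section Code

variable {m₁ n₁ m₂ n₂ : ℕ}
variable (h₁ : Matrix (Fin m₁) (Fin n₁) (ZMod 2)) (h₂ : Matrix (Fin m₂) (Fin n₂) (ZMod 2))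

/-- `H_X = (h₁ ⊗ 1 | 1 ⊗ h₂ᵀ)`. -/
def HX : Matrix (Fin m₁ × Fin n₂) (LeftQ n₁ n₂ ⊕ RightQ m₁ m₂) (ZMod 2) :=
  Matrix.fromCols (h₁ ⊗ₖ (1 : Matrix (Fin n₂) (Fin n₂) (ZMod 2)))
    ((1 : Matrix (Fin m₁) (Fin m₁) (ZMod 2)) ⊗ₖ h₂.transpose)

/-- `H_Z = (1 ⊗ h₂ | h₁ᵀ ⊗ 1)`. -/
def HZ : Matrix (Fin n₁ × Fin m₂) (LeftQ n₁ n₂ ⊕ RightQ m₁ m₂) (ZMod 2) :=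
  Matrix.fromCols ((1 : Matrix (Fin n₁) (Fin n₁) (ZMod 2)) ⊗ₖ h₂)
    (h₁.transpose ⊗ₖ (1 : Matrix (Fin m₂) (Fin m₂) (ZMod 2)))

/-- `X`-type gauge operators of the left-sector code: generated by the `X`-stabilizers (rows of
`H_X`) and the right-sector logical `X` operators `(0 | a ⊗ b)` with `a ∈ ker h₁ᵀ`. (If `b` is in
the image of `h₂`, this operator is a stabilizer, so the group does not depend on which unit vectors
`b` outside this image are chosen as canonical representatives.) -/
def gaugeX : Submodule (ZMod 2) (LeftQ n₁ n₂ ⊕ RightQ m₁ m₂ → ZMod 2) :=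
  Submodule.span (ZMod 2) (Set.range (HX h₁ h₂)) ⊔
    Submodule.span (ZMod 2)
      {x | ∃ (a : Fin m₁ → ZMod 2) (b : Fin m₂ → ZMod 2), h₁.transpose.mulVec a = 0 ∧
        x = Sum.elim (fun _ => 0) (fun r => a r.1 * b r.2)}

/-- `Z`-type gauge operators of the left-sector code: generated by the `Z`-stabilizers (rows of
`H_Z`) and the right-sector logical `Z` operators `(0 | a ⊗ b)` with `b ∈ ker h₂ᵀ`. -/
def gaugeZ : Submodule (ZMod 2) (LeftQ n₁ n₂ ⊕ RightQ m₁ m₂ → ZMod 2) :=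
  Submodule.span (ZMod 2) (Set.range (HZ h₁ h₂)) ⊔
    Submodule.span (ZMod 2)
      {z | ∃ (a : Fin m₁ → ZMod 2) (b : Fin m₂ → ZMod 2), h₂.transpose.mulVec b = 0 ∧
        z = Sum.elim (fun _ => 0) (fun r => a r.1 * b r.2)}

/-- `E` is a nontrivial (dressed) logical operator of the left-sector hypergraph product code: it
commutes with all stabilizers and is not a gauge operator. -/
def IsLogical (E : Pauli (LeftQ n₁ n₂ ⊕ RightQ m₁ m₂)) : Prop :=
  ((HZ h₁ h₂).mulVec E.1 = 0 ∧ (HX h₁ h₂).mulVec E.2 = 0) ∧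
    ¬ (E.1 ∈ gaugeX h₁ h₂ ∧ E.2 ∈ gaugeZ h₁ h₂)

/-- The distance `d` of the left-sector code: the least weight of a nontrivial dressed logical
operator (`⊤` if there is none, that is, if the code has no logical qubit). -/
noncomputable def distance : ℕ∞ :=
  ⨅ (E : Pauli (LeftQ n₁ n₂ ⊕ RightQ m₁ m₂)) (_ : IsLogical h₁ h₂ E), (E.weight : ℕ∞)

end Code

/-- The minimum distance of the classical code `ker h`. -/
noncomputable def minDist {m n : ℕ} (h : Matrix (Fin m) (Fin n) (ZMod 2)) : ℕ∞ :=
  ⨅ (c : Fin n → ZMod 2) (_ : c ≠ 0 ∧ h.mulVec c = 0), (hammingNorm c : ℕ∞)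

/-- `U₁ = (σ₁ ⊗ 1) ⊕ (w₁ ⊗ 1)`. -/
noncomputable def gadget₁ {m₁ n₁ : ℕ} (m₂ n₂ : ℕ) (σ₁ : Equiv.Perm (Fin n₁))
    (w₁ : Matrix.GeneralLinearGroup (Fin m₁) (ZMod 2)) :
    Matrix (LeftQ n₁ n₂ ⊕ RightQ m₁ m₂) (LeftQ n₁ n₂ ⊕ RightQ m₁ m₂) (ZMod 2) :=
  Matrix.fromBlocks (σ₁.permMatrix (ZMod 2) ⊗ₖ (1 : Matrix (Fin n₂) (Fin n₂) (ZMod 2))) 0 0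
    ((w₁ : Matrix (Fin m₁) (Fin m₁) (ZMod 2)) ⊗ₖ (1 : Matrix (Fin m₂) (Fin m₂) (ZMod 2)))

/-- `U₂ = (1 ⊗ σ₂) ⊕ (1 ⊗ w₂⁻ᵀ)`. -/
noncomputable def gadget₂ (m₁ n₁ : ℕ) {m₂ n₂ : ℕ} (σ₂ : Equiv.Perm (Fin n₂))
    (w₂ : Matrix.GeneralLinearGroup (Fin m₂) (ZMod 2)) :
    Matrix (LeftQ n₁ n₂ ⊕ RightQ m₁ m₂) (LeftQ n₁ n₂ ⊕ RightQ m₁ m₂) (ZMod 2) :=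
  Matrix.fromBlocks ((1 : Matrix (Fin n₁) (Fin n₁) (ZMod 2)) ⊗ₖ σ₂.permMatrix (ZMod 2)) 0 0
    ((1 : Matrix (Fin m₁) (Fin m₁) (ZMod 2)) ⊗ₖ
      ((w₂⁻¹ : Matrix.GeneralLinearGroup (Fin m₂) (ZMod 2)) :
        Matrix (Fin m₂) (Fin m₂) (ZMod 2)).transpose)

/-- One time step of a physical circuit that only permutes the left sector `L`: a physical
permutation of the qubits inside each sector, followed by a layer of Clifford gates with disjoint
supports on the right sector `R`. The classes of `gates` are the supports of the gates; a one-qubit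
class is a one-qubit gate or an idling qubit. Every left qubit idles during the layer. -/
structure Step (L R : Type) [Fintype R] where
  permL : Equiv.Perm L
  permR : Equiv.Perm R
  gates : Setoid R
  /-- the action of the layer on Pauli operators by conjugation, up to phases -/
  act : Pauli R ≃ₗ[ZMod 2] Pauli R
  symp_act : ∀ E E' : Pauli R, (act E).symp (act E') = E.symp E'
  /-- the layer is a product of gates acting on the classes of `gates` -/
  act_local : ∀ (E : Pauli R) (r : R), (∀ r', gates r r' → r' ∉ E.supp) → r ∉ (act E).supp

namespace Step

variable {L R : Type} [Fintype R]

/-- The action of an ideal time step on Pauli operators. -/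
def conj (s : Step L R) (E : Pauli (L ⊕ R)) : Pauli (L ⊕ R) :=
  let E' : Pauli R :=
    s.act (fun r => E.1 (Sum.inr (s.permR.symm r)), fun r => E.2 (Sum.inr (s.permR.symm r)))
  (Sum.elim (fun l => E.1 (Sum.inl (s.permL.symm l))) E'.1,
    Sum.elim (fun l => E.2 (Sum.inl (s.permL.symm l))) E'.2)

/-- The number of faulty locations needed to insert the Pauli error `E` right after the time step.
The locations are the gates and the idling qubits; a faulty one leaves an arbitrary Pauli error on
its support. Permutations are not locations. -/
noncomputable def faultCount (s : Step L R) (E : Pauli (L ⊕ R)) : ℕ :=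
  {l : L | Sum.inl l ∈ E.supp}.ncard +
    ((Quotient.mk s.gates) '' {r : R | Sum.inr r ∈ E.supp}).ncard

end Step

/-- A physical circuit: a finite sequence of time steps. -/
structure Circuit (L R : Type) [Fintype R] where
  depth : ℕ
  step : Fin depth → Step L R

namespace Circuit

variable {L R : Type} [Fintype R]

/-- The action of the ideal circuit on Pauli operators. -/
def action (C : Circuit L R) (E : Pauli (L ⊕ R)) : Pauli (L ⊕ R) :=
  Fin.foldl C.depth (fun E' i => (C.step i).conj E') E

/-- The ideal circuit implements the Clifford operation given by the invertible matrix `U`: it maps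
the `X`-support `x` (a row vector) to `x U` and the `Z`-support `z` to `z U⁻ᵀ`. -/
def Implements [Fintype L] [DecidableEq L] [DecidableEq R]
    (C : Circuit L R) (U : Matrix (L ⊕ R) (L ⊕ R) (ZMod 2)) : Prop :=
  ∀ E : Pauli (L ⊕ R),
    C.action E = (Matrix.vecMul E.1 U, Matrix.vecMul E.2 U⁻¹.transpose)

/-- A pattern of faults: Pauli errors on the idling data qubits before the first time step, and after
each time step the product of the Pauli errors left by its faulty locations. -/
structure Faults (C : Circuit L R) where
  before : Pauli (L ⊕ R)
  after : Fin C.depth → Pauli (L ⊕ R)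

/-- The number of elementary faults of a pattern of faults. -/
noncomputable def Faults.count {C : Circuit L R} (F : C.Faults) : ℕ :=
  F.before.weight + ∑ i, (C.step i).faultCount (F.after i)

/-- The Pauli error at the end of the faulty circuit, relative to the ideal circuit: all faults,
propagated through the rest of the circuit. -/
def Faults.residual {C : Circuit L R} (F : C.Faults) : Pauli (L ⊕ R) :=
  Fin.foldl C.depth (fun E i => (C.step i).conj E + F.after i) F.before

end Circuit

/-- The effective fault distance `d_eff` of a circuit on the left-sector code: the least number of
elementary faults whose residual error is a nontrivial dressed logical operator. -/
noncomputable def effectiveFaultDistance {m₁ n₁ m₂ n₂ : ℕ}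
    (h₁ : Matrix (Fin m₁) (Fin n₁) (ZMod 2)) (h₂ : Matrix (Fin m₂) (Fin n₂) (ZMod 2))
    (C : Circuit (LeftQ n₁ n₂) (RightQ m₁ m₂)) : ℕ∞ :=
  ⨅ (F : C.Faults) (_ : IsLogical h₁ h₂ F.residual), (F.count : ℕ∞)

end LeftHGP

/-!
The circuits only permute the left qubits, so a fault of an idling left qubit ends up as an error on
a single left qubit, and errors on the right sector, however large, never reach the left sector.
Hence the weight of the residual error *restricted to the left sector* is at most the number of
faults (`leftWeight_residual_le`).  It remains to see that the left part alone of a nontrivial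
dressed logical operator already has weight at least `min d₁ d₂`.  Such an operator has a nontrivial
`X`-part or a nontrivial `Z`-part, and these can be treated separately.

Write the left part of an `X`-support `x` as an `n₁ × n₂` matrix `A`.  If `x` commutes with the
`Z`-stabilizers, then `uᵀ A ∈ ker h₂` for all `u ∈ ker h₁` (`mulVec_contract`), and `x` is a gauge
operator exactly if `uᵀ A = 0` for all such `u` (`mem_gaugeX_iff`): the columns of `A` are then
orthogonal to `ker h₁`, so they lie in the row space of `h₁`, and `x` agrees with an `X`-stabilizer
up to an operator on the right sector, which is a gauge operator.  So a nontrivial `x` gives a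
nonzero `uᵀ A ∈ ker h₂`, supported on the nonzero columns of `A`; there are at least `d₂` of these.
The `Z`-type case is the `X`-type case of the product of `h₂` and `h₁`, by exchanging the factors
(`gaugeZ_eq_map`).

Conversely, if `c ∈ ker h₂` and `u ∈ ker h₁` with `u i ≠ 0`, then the `X`-operator `(eᵢ ⊗ c | 0)` is
a nontrivial logical operator of weight `|c|`, and any Pauli error arises as the residual of faults
no more numerous than its weight, all at the end of the circuit (`exists_faults_residual_eq`).
-/

namespace LeftHGP

/-! ### Contraction of the left part with a codeword -/

section Contract

variable {m₁ n₁ m₂ n₂ : ℕ}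

/-- The row vector `uᵀ A`, where the `n₁ × n₂` matrix `A` is the left part of `x`. -/
def contract (u : Fin n₁ → ZMod 2) :
    (LeftQ n₁ n₂ ⊕ RightQ m₁ m₂ → ZMod 2) →ₗ[ZMod 2] (Fin n₂ → ZMod 2) where
  toFun x j := ∑ i, u i * x (Sum.inl (i, j))
  map_add' x y := by ext j; simp [mul_add, Finset.sum_add_distrib]
  map_smul' c x := by ext j; simp [Finset.mul_sum, mul_left_comm]

theorem contract_apply (u : Fin n₁ → ZMod 2) (x : LeftQ n₁ n₂ ⊕ RightQ m₁ m₂ → ZMod 2)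
    (j : Fin n₂) : contract u x j = ∑ i, u i * x (Sum.inl (i, j)) := rfl

variable (h₁ : Matrix (Fin m₁) (Fin n₁) (ZMod 2)) (h₂ : Matrix (Fin m₂) (Fin n₂) (ZMod 2))

theorem HZ_mulVec_apply (x : LeftQ n₁ n₂ ⊕ RightQ m₁ m₂ → ZMod 2) (i : Fin n₁) (k : Fin m₂) :
    (HZ h₁ h₂).mulVec x (i, k) =
      ∑ j, h₂ k j * x (Sum.inl (i, j)) + ∑ l, h₁ l i * x (Sum.inr (l, k)) := by
  simp [HZ, Matrix.mulVec, dotProduct, Fintype.sum_prod_type, Matrix.one_apply]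

theorem HX_apply_inl (l : Fin m₁) (j : Fin n₂) (q : LeftQ n₁ n₂) :
    HX h₁ h₂ (l, j) (Sum.inl q) = h₁ l q.1 * if j = q.2 then 1 else 0 := by
  simp [HX, Matrix.one_apply, Matrix.kroneckerMap_apply]

theorem HX_apply_inr (l : Fin m₁) (j : Fin n₂) (r : RightQ m₁ m₂) :
    HX h₁ h₂ (l, j) (Sum.inr r) = (if l = r.1 then 1 else 0) * h₂ r.2 j := by
  simp [HX, Matrix.one_apply, Matrix.kroneckerMap_apply]

theorem mulVec_contract {u : Fin n₁ → ZMod 2} (hu : h₁.mulVec u = 0)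
    {x : LeftQ n₁ n₂ ⊕ RightQ m₁ m₂ → ZMod 2} (hx : (HZ h₁ h₂).mulVec x = 0) :
    h₂.mulVec (contract u x) = 0 := by
  ext k
  have hl (l : Fin m₁) : ∑ i, u i * h₁ l i = 0 := by
    simpa [Matrix.mulVec, dotProduct, mul_comm] using congrFun hu l
  have hright : ∑ i, u i * ∑ l, h₁ l i * x (Sum.inr (l, k)) = 0 := by
    simp_rw [Finset.mul_sum, ← mul_assoc]
    rw [Finset.sum_comm]
    simp [← Finset.sum_mul, hl]
  have htotal : ∑ i, u i * (HZ h₁ h₂).mulVec x (i, k) = 0 := by simp [hx]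
  simp_rw [HZ_mulVec_apply, mul_add, Finset.sum_add_distrib] at htotal
  rw [hright, add_zero] at htotal
  simp_rw [Finset.mul_sum] at htotal
  rw [Finset.sum_comm] at htotal
  simpa [Matrix.mulVec, dotProduct, contract_apply, Finset.mul_sum, mul_left_comm] using htotal

end Contract

/-! ### Gauge operators -/

/-- A vector orthogonal to `ker h` is in the row space of `h`. -/
theorem exists_vecMul_eq_of_orthogonal_ker {m n : ℕ} (h : Matrix (Fin m) (Fin n) (ZMod 2))
    (a : Fin n → ZMod 2) (ha : ∀ u, h.mulVec u = 0 → ∑ i, u i * a i = 0) :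
    ∃ y, Matrix.vecMul y h = a := by
  let f : Module.Dual (ZMod 2) (Fin n → ZMod 2) := Fintype.linearCombination (ZMod 2) a
  have hf (u : Fin n → ZMod 2) : f u = ∑ i, u i * a i := by
    simp [f, Fintype.linearCombination_apply]
  have hmem : f ∈ LinearMap.range h.mulVecLin.dualMap := by
    rw [LinearMap.range_dualMap_eq_dualAnnihilator_ker, Submodule.mem_dualAnnihilator]
    intro u hu
    rw [hf]
    exact ha u (by simpa using hu)
  obtain ⟨g, hg⟩ := hmem
  refine ⟨fun l => g (Pi.single l 1), ?_⟩
  ext i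
  have hi : f (Pi.single i 1) = a i := by simp [hf, Pi.single_apply]
  rw [← hi, ← hg, LinearMap.dualMap_apply, Matrix.mulVecLin_apply]
  rw [LinearMap.pi_apply_eq_sum_univ g]
  simp only [Matrix.vecMul, dotProduct, Matrix.mulVec_single_one, Matrix.col_apply, smul_eq_mul,
    mul_comm]
  exact Finset.sum_congr rfl fun l _ => by
    congr 2
    ext l'
    simp [Pi.single_apply, eq_comm]

section Gauge

variable {m₁ n₁ m₂ n₂ : ℕ}
variable (h₁ : Matrix (Fin m₁) (Fin n₁) (ZMod 2)) (h₂ : Matrix (Fin m₂) (Fin n₂) (ZMod 2))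

theorem contract_eq_zero_of_mem_gaugeX {u : Fin n₁ → ZMod 2} (hu : h₁.mulVec u = 0)
    {x : LeftQ n₁ n₂ ⊕ RightQ m₁ m₂ → ZMod 2} (hx : x ∈ gaugeX h₁ h₂) : contract u x = 0 := by
  suffices gaugeX h₁ h₂ ≤ LinearMap.ker (contract u) from this hx
  refine sup_le (Submodule.span_le.2 ?_) (Submodule.span_le.2 ?_)
  · rintro _ ⟨⟨l, j⟩, rfl⟩
    have hl : ∑ i, u i * h₁ l i = 0 := by
      simpa [Matrix.mulVec, dotProduct, mul_comm] using congrFun hu l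
    ext j'
    simpa [contract_apply, HX_apply_inl] using fun _ => hl
  · rintro _ ⟨a, b, -, rfl⟩
    ext j
    simp [contract_apply]

/-- Operators `(0 | B)` with `h₁ᵀ B = 0` are gauge operators. -/
theorem mem_gaugeX_of_right {x : LeftQ n₁ n₂ ⊕ RightQ m₁ m₂ → ZMod 2}
    (hleft : ∀ q, x (Sum.inl q) = 0) (hx : (HZ h₁ h₂).mulVec x = 0) : x ∈ gaugeX h₁ h₂ := by
  have hsum : x = ∑ k : Fin m₂, (Sum.elim (fun _ => 0)
      (fun r => x (Sum.inr (r.1, k)) * (Pi.single k 1 : Fin m₂ → ZMod 2) r.2)) := by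
    ext q
    rcases q with q | r
    · simp [hleft, Finset.sum_apply]
    · simp [Finset.sum_apply, Pi.single_apply]
  rw [hsum]
  refine Submodule.mem_sup_right (Submodule.sum_mem _ fun k _ => Submodule.subset_span ?_)
  refine ⟨fun l => x (Sum.inr (l, k)), Pi.single k 1, ?_, rfl⟩
  ext i
  have hik := congrFun hx (i, k)
  rw [HZ_mulVec_apply] at hik
  simpa [hleft, Matrix.mulVec, dotProduct] using hik

/-- `X`-stabilizers commute with `Z`-stabilizers. -/
theorem HZ_mulVec_HX (p : Fin m₁ × Fin n₂) : (HZ h₁ h₂).mulVec (HX h₁ h₂ p) = 0 := by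
  obtain ⟨l, j⟩ := p
  ext ⟨i, k⟩
  rw [HZ_mulVec_apply]
  simp only [HX_apply_inl, HX_apply_inr]
  simp [mul_comm, CharTwo.add_self_eq_zero]

/-- An operator commuting with the `Z`-stabilizers is a gauge operator exactly if its left part is
orthogonal to `ker h₁`. -/
theorem mem_gaugeX_iff {x : LeftQ n₁ n₂ ⊕ RightQ m₁ m₂ → ZMod 2}
    (hx : (HZ h₁ h₂).mulVec x = 0) :
    x ∈ gaugeX h₁ h₂ ↔ ∀ u, h₁.mulVec u = 0 → contract u x = 0 := by
  refine ⟨fun hmem u hu => contract_eq_zero_of_mem_gaugeX h₁ h₂ hu hmem, fun horth => ?_⟩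
  choose y hy using fun j => exists_vecMul_eq_of_orthogonal_ker h₁ (fun i => x (Sum.inl (i, j)))
    fun u hu => congrFun (horth u hu) j
  -- the stabilizer with the same left part as `x`
  let s : LeftQ n₁ n₂ ⊕ RightQ m₁ m₂ → ZMod 2 := ∑ p : Fin m₁ × Fin n₂, y p.2 p.1 • HX h₁ h₂ p
  have hs : s ∈ gaugeX h₁ h₂ := Submodule.mem_sup_left <|
    Submodule.sum_mem _ fun p _ => Submodule.smul_mem _ _ (Submodule.subset_span ⟨p, rfl⟩)
  have hsz : (HZ h₁ h₂).mulVec s = 0 := by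
    rw [← Matrix.mulVecLin_apply, map_sum]
    simp [HZ_mulVec_HX]
  have hdiff : x - s ∈ gaugeX h₁ h₂ := by
    refine mem_gaugeX_of_right h₁ h₂ ?_ (by rw [Matrix.mulVec_sub, hx, hsz, sub_zero])
    rintro ⟨i, j⟩
    have hij := congrFun (hy j) i
    simp only [Matrix.vecMul, dotProduct] at hij
    simp [s, Finset.sum_apply, Fintype.sum_prod_type, HX_apply_inl, hij]
  simpa using Submodule.add_mem _ hdiff hs

end Gauge

/-! ### Exchanging the two factors -/

section Swap

variable {m₁ n₁ m₂ n₂ : ℕ}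

/-- The identification of the qubits of the product of `h₁` and `h₂` with those of the product of
`h₂` and `h₁`. -/
def swapQ (m₁ n₁ m₂ n₂ : ℕ) : LeftQ n₁ n₂ ⊕ RightQ m₁ m₂ ≃ LeftQ n₂ n₁ ⊕ RightQ m₂ m₁ :=
  Equiv.sumCongr (Equiv.prodComm _ _) (Equiv.prodComm _ _)

variable (h₁ : Matrix (Fin m₁) (Fin n₁) (ZMod 2)) (h₂ : Matrix (Fin m₂) (Fin n₂) (ZMod 2))

theorem HX_swap (p : Fin m₂ × Fin n₁) : HX h₂ h₁ p ∘ swapQ m₁ n₁ m₂ n₂ = HZ h₁ h₂ p.swap := by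
  obtain ⟨k, i⟩ := p
  ext q
  rcases q with ⟨i', j⟩ | ⟨l, k'⟩ <;>
    simp [HX, HZ, swapQ, Matrix.kroneckerMap_apply, mul_comm]

theorem HX_mulVec_swap (z : LeftQ n₂ n₁ ⊕ RightQ m₂ m₁ → ZMod 2) (p : Fin m₁ × Fin n₂) :
    (HX h₁ h₂).mulVec (z ∘ swapQ m₁ n₁ m₂ n₂) p = (HZ h₂ h₁).mulVec z p.swap := by
  refine Fintype.sum_equiv (swapQ m₁ n₁ m₂ n₂) _ _ fun q => ?_
  rw [← HX_swap h₂ h₁ p]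
  rcases q with q | q <;> rfl

theorem gaugeZ_eq_map :
    gaugeZ h₁ h₂ =
      (gaugeX h₂ h₁).map (LinearMap.funLeft (ZMod 2) (ZMod 2) (swapQ m₁ n₁ m₂ n₂)) := by
  rw [gaugeZ, gaugeX, Submodule.map_sup, Submodule.map_span, Submodule.map_span]
  congr 2
  · ext z
    constructor
    · rintro ⟨p, rfl⟩
      exact ⟨_, ⟨p.swap, rfl⟩, HX_swap h₁ h₂ p.swap⟩
    · rintro ⟨_, ⟨p, rfl⟩, rfl⟩
      exact ⟨p.swap, (HX_swap h₁ h₂ p).symm⟩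
  · ext z
    constructor
    · rintro ⟨a, b, hb, rfl⟩
      refine ⟨_, ⟨b, a, hb, rfl⟩, ?_⟩
      ext q
      rcases q with q | q <;> simp [LinearMap.funLeft_apply, swapQ, mul_comm]
    · rintro ⟨_, ⟨b, a, hb, rfl⟩, rfl⟩
      refine ⟨a, b, hb, ?_⟩
      ext q
      rcases q with q | q <;> simp [LinearMap.funLeft_apply, swapQ, mul_comm]

theorem comp_swap_mem_gaugeZ_iff (z : LeftQ n₂ n₁ ⊕ RightQ m₂ m₁ → ZMod 2) :
    z ∘ swapQ m₁ n₁ m₂ n₂ ∈ gaugeZ h₁ h₂ ↔ z ∈ gaugeX h₂ h₁ := by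
  rw [gaugeZ_eq_map]
  constructor
  · rintro ⟨z', hz', heq⟩
    rwa [(swapQ m₁ n₁ m₂ n₂).surjective.injective_comp_right heq] at hz'
  · exact fun hz => ⟨z, hz, rfl⟩

theorem HX_mulVec_swap_eq_zero_iff (z : LeftQ n₂ n₁ ⊕ RightQ m₂ m₁ → ZMod 2) :
    (HX h₁ h₂).mulVec (z ∘ swapQ m₁ n₁ m₂ n₂) = 0 ↔ (HZ h₂ h₁).mulVec z = 0 := by
  constructor
  · intro hz
    ext p
    simpa [HX_mulVec_swap] using congrFun hz p.swap
  · intro hz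
    ext p
    rw [HX_mulVec_swap, hz]
    rfl

end Swap

/-! ### The weight of logical operators on the left sector -/

/-- The number of left qubits on which a Pauli operator acts nontrivially. -/
noncomputable def leftWeight {L R : Type} (E : Pauli (L ⊕ R)) : ℕ :=
  {l : L | Sum.inl l ∈ E.supp}.ncard

section Weight

variable {m₁ n₁ m₂ n₂ : ℕ}
variable (h₁ : Matrix (Fin m₁) (Fin n₁) (ZMod 2)) (h₂ : Matrix (Fin m₂) (Fin n₂) (ZMod 2))

theorem minDist_le {m n : ℕ} {h : Matrix (Fin m) (Fin n) (ZMod 2)} {c : Fin n → ZMod 2}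
    (hc : c ≠ 0) (hker : h.mulVec c = 0) : minDist h ≤ hammingNorm c :=
  iInf₂_le c ⟨hc, hker⟩

theorem hammingNorm_contract_le (u : Fin n₁ → ZMod 2)
    (x : LeftQ n₁ n₂ ⊕ RightQ m₁ m₂ → ZMod 2) :
    hammingNorm (contract u x) ≤ {q : LeftQ n₁ n₂ | x (Sum.inl q) ≠ 0}.ncard := by
  have hsub : {j | contract u x j ≠ 0} ⊆
      Prod.snd '' {q : LeftQ n₁ n₂ | x (Sum.inl q) ≠ 0} := by
    intro j hj
    have hsum : ∑ i, u i * x (Sum.inl (i, j)) ≠ 0 := hj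
    obtain ⟨i, -, hi⟩ := Finset.exists_ne_zero_of_sum_ne_zero hsum
    exact ⟨(i, j), right_ne_zero_of_mul hi, rfl⟩
  have hnorm : hammingNorm (contract u x) = {j | contract u x j ≠ 0}.ncard := by
    rw [Set.ncard_eq_toFinset_card', hammingNorm]
    congr 1
    ext j
    simp
  rw [hnorm]
  exact (Set.ncard_le_ncard hsub (Set.toFinite _)).trans (Set.ncard_image_le (Set.toFinite _))

/-- A nontrivial logical `X`-operator yields nonzero codewords of both classical codes, and the one
of `h₂` has weight at most that of the left part. -/
theorem exists_codewords_of_notMem_gaugeX {x : LeftQ n₁ n₂ ⊕ RightQ m₁ m₂ → ZMod 2}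
    (hx : (HZ h₁ h₂).mulVec x = 0) (hgauge : x ∉ gaugeX h₁ h₂) :
    (∃ u, u ≠ 0 ∧ h₁.mulVec u = 0) ∧ ∃ c, c ≠ 0 ∧ h₂.mulVec c = 0 ∧
      hammingNorm c ≤ {q : LeftQ n₁ n₂ | x (Sum.inl q) ≠ 0}.ncard := by
  rw [mem_gaugeX_iff h₁ h₂ hx] at hgauge
  push Not at hgauge
  obtain ⟨u, hu, hne⟩ := hgauge
  refine ⟨⟨u, ?_, hu⟩, contract u x, hne, mulVec_contract h₁ h₂ hu hx,
    hammingNorm_contract_le u x⟩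
  rintro rfl
  exact hne (by ext j; simp [contract_apply])

/-- A nontrivial logical operator exists only if both classical codes are nonzero, and the weight of
its left part is at least one of the classical distances. -/
theorem IsLogical.ker_ne_bot_and_le_leftWeight {E : Pauli (LeftQ n₁ n₂ ⊕ RightQ m₁ m₂)}
    (hE : IsLogical h₁ h₂ E) :
    (LinearMap.ker h₁.mulVecLin ≠ ⊥ ∧ LinearMap.ker h₂.mulVecLin ≠ ⊥) ∧
      min (minDist h₁) (minDist h₂) ≤ (leftWeight E : ℕ∞) := by
  have ker_ne {m n : ℕ} {h : Matrix (Fin m) (Fin n) (ZMod 2)} {u : Fin n → ZMod 2}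
      (hu : u ≠ 0) (hker : h.mulVec u = 0) : LinearMap.ker h.mulVecLin ≠ ⊥ :=
    Submodule.ne_bot_iff _ |>.2 ⟨u, by simpa using hker, hu⟩
  obtain ⟨⟨hX, hZ⟩, hgauge⟩ := hE
  by_cases hmem : E.1 ∈ gaugeX h₁ h₂
  · obtain ⟨z, hz⟩ : ∃ z, E.2 = z ∘ swapQ m₁ n₁ m₂ n₂ :=
      ⟨E.2 ∘ (swapQ m₁ n₁ m₂ n₂).symm, by ext q; simp⟩
    have hnot : z ∉ gaugeX h₂ h₁ := by
      rw [← comp_swap_mem_gaugeZ_iff h₁ h₂, ← hz]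
      exact fun hz => hgauge ⟨hmem, hz⟩
    rw [hz, HX_mulVec_swap_eq_zero_iff] at hZ
    obtain ⟨⟨u, hu, huker⟩, c, hc, hcker, hle⟩ := exists_codewords_of_notMem_gaugeX h₂ h₁ hZ hnot
    refine ⟨⟨ker_ne hc hcker, ker_ne hu huker⟩,
      (min_le_left _ _).trans ((minDist_le hc hcker).trans ?_)⟩
    have hsub : {q : LeftQ n₂ n₁ | z (Sum.inl q) ≠ 0} ⊆
        Prod.swap '' {q : LeftQ n₁ n₂ | Sum.inl q ∈ E.supp} := by
      intro q hq
      refine ⟨q.swap, Or.inr ?_, q.swap_swap⟩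
      rw [hz]
      exact hq
    exact_mod_cast hle.trans ((Set.ncard_le_ncard hsub (Set.toFinite _)).trans
      (Set.ncard_image_le (Set.toFinite _)))
  · obtain ⟨⟨u, hu, huker⟩, c, hc, hcker, hle⟩ := exists_codewords_of_notMem_gaugeX h₁ h₂ hX hmem
    refine ⟨⟨ker_ne hu huker, ker_ne hc hcker⟩,
      (min_le_right _ _).trans ((minDist_le hc hcker).trans ?_)⟩
    exact_mod_cast hle.trans (Set.ncard_le_ncard (fun q hq => Or.inl hq) (Set.toFinite _))

theorem weight_eq_add {L R : Type} [Fintype L] [Fintype R] (E : Pauli (L ⊕ R)) :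
    E.weight = leftWeight E + {r : R | Sum.inr r ∈ E.supp}.ncard := by
  have hunion : E.supp =
      Sum.inl '' {l : L | Sum.inl l ∈ E.supp} ∪ Sum.inr '' {r : R | Sum.inr r ∈ E.supp} := by
    ext q
    rcases q with q | q <;> simp
  rw [Pauli.weight, hunion, Set.ncard_union_eq ?_ (Set.toFinite _) (Set.toFinite _),
    Set.ncard_image_of_injective _ Sum.inl_injective,
    Set.ncard_image_of_injective _ Sum.inr_injective, ← hunion, leftWeight]
  rw [Set.disjoint_left]
  rintro _ ⟨l, -, rfl⟩ ⟨r, -, h⟩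
  cases h

end Weight

/-! ### The distance -/

section Distance

variable {m₁ n₁ m₂ n₂ : ℕ}
variable (h₁ : Matrix (Fin m₁) (Fin n₁) (ZMod 2)) (h₂ : Matrix (Fin m₂) (Fin n₂) (ZMod 2))

/-- A nonzero codeword `c` of `h₂`, placed on a row of the left sector on which some codeword of `h₁`
is supported, is a nontrivial logical `X`-operator. -/
theorem exists_notMem_gaugeX_ncard_eq {u : Fin n₁ → ZMod 2} (hu : u ≠ 0)
    (huker : h₁.mulVec u = 0) {c : Fin n₂ → ZMod 2} (hc : c ≠ 0) (hcker : h₂.mulVec c = 0) :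
    ∃ x : LeftQ n₁ n₂ ⊕ RightQ m₁ m₂ → ZMod 2,
      (HZ h₁ h₂).mulVec x = 0 ∧ x ∉ gaugeX h₁ h₂ ∧ {q | x q ≠ 0}.ncard = hammingNorm c := by
  obtain ⟨i₀, hi₀⟩ := Function.ne_iff.1 hu
  obtain ⟨j₀, hj₀⟩ := Function.ne_iff.1 hc
  refine ⟨Sum.elim (fun q => if q.1 = i₀ then c q.2 else 0) (fun _ => 0), ?_, ?_, ?_⟩
  · ext ⟨i, k⟩
    rw [HZ_mulVec_apply]
    by_cases hi : i = i₀
    · simpa [hi, Matrix.mulVec, dotProduct] using congrFun hcker k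
    · simp [hi]
  · intro hmem
    have hzero := congrFun (contract_eq_zero_of_mem_gaugeX h₁ h₂ huker hmem) j₀
    simp only [contract_apply, Sum.elim_inl, mul_ite, mul_zero, Finset.sum_ite_eq',
      Finset.mem_univ, if_true] at hzero
    exact (mul_ne_zero hi₀ hj₀) hzero
  · have himage : {q : LeftQ n₁ n₂ ⊕ RightQ m₁ m₂ | (Sum.elim
        (fun q : LeftQ n₁ n₂ => if q.1 = i₀ then c q.2 else 0) (fun _ => 0) : _ → ZMod 2) q ≠ 0} =
        (fun j => Sum.inl (i₀, j)) '' {j | c j ≠ 0} := by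
      ext q
      rcases q with ⟨i, j⟩ | r
      · simp [and_comm, eq_comm]
      · simp
    rw [himage, Set.ncard_image_of_injective _ fun j j' hjj => by simpa using hjj,
      Set.ncard_eq_toFinset_card', hammingNorm]
    congr 1
    ext j
    simp

theorem distance_le_minDist_right (hker : LinearMap.ker h₁.mulVecLin ≠ ⊥) :
    distance h₁ h₂ ≤ minDist h₂ := by
  obtain ⟨u, hu, hu0⟩ := (Submodule.ne_bot_iff _).1 hker
  refine le_iInf₂ fun c hc => ?_
  obtain ⟨x, hx, hgauge, hcard⟩ :=
    exists_notMem_gaugeX_ncard_eq h₁ h₂ hu0 (by simpa using hu) hc.1 hc.2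
  refine (iInf₂_le (x, 0) ⟨⟨hx, Matrix.mulVec_zero _⟩, fun h => hgauge h.1⟩).trans ?_
  simp [Pauli.weight, Pauli.supp, hcard]

theorem distance_le_minDist_left (hker : LinearMap.ker h₂.mulVecLin ≠ ⊥) :
    distance h₁ h₂ ≤ minDist h₁ := by
  obtain ⟨u, hu, hu0⟩ := (Submodule.ne_bot_iff _).1 hker
  refine le_iInf₂ fun c hc => ?_
  obtain ⟨z, hz, hgauge, hcard⟩ :=
    exists_notMem_gaugeX_ncard_eq h₂ h₁ hu0 (by simpa using hu) hc.1 hc.2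
  refine (iInf₂_le (0, z ∘ swapQ m₁ n₁ m₂ n₂) ⟨⟨Matrix.mulVec_zero _,
    (HX_mulVec_swap_eq_zero_iff h₁ h₂ z).2 hz⟩,
    fun h => hgauge ((comp_swap_mem_gaugeZ_iff h₁ h₂ z).1 h.2)⟩).trans ?_
  have hpre : {q | (z ∘ swapQ m₁ n₁ m₂ n₂) q ≠ 0} =
      (swapQ m₁ n₁ m₂ n₂) ⁻¹' {q | z q ≠ 0} := rfl
  have hncard : {q | (z ∘ swapQ m₁ n₁ m₂ n₂) q ≠ 0}.ncard = hammingNorm c := by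
    rw [hpre, Set.ncard_preimage_of_injective_subset_range (Equiv.injective _) (by simp), hcard]
  have hweight : Pauli.weight (0, z ∘ swapQ m₁ n₁ m₂ n₂) = hammingNorm c := by
    rw [← hncard]
    simp [Pauli.weight, Pauli.supp]
  exact_mod_cast hweight.le

theorem distance_eq_min (hker₁ : LinearMap.ker h₁.mulVecLin ≠ ⊥)
    (hker₂ : LinearMap.ker h₂.mulVecLin ≠ ⊥) :
    distance h₁ h₂ = min (minDist h₁) (minDist h₂) := by
  refine le_antisymm (le_min (distance_le_minDist_left h₁ h₂ hker₂)
    (distance_le_minDist_right h₁ h₂ hker₁)) (le_iInf₂ fun E hE => ?_)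
  refine (hE.ker_ne_bot_and_le_leftWeight h₁ h₂).2.trans ?_
  rw [weight_eq_add]
  exact_mod_cast Nat.le_add_right _ _

/-- The left part alone of a nontrivial logical operator has weight at least the distance. -/
theorem IsLogical.distance_le_leftWeight {E : Pauli (LeftQ n₁ n₂ ⊕ RightQ m₁ m₂)}
    (hE : IsLogical h₁ h₂ E) : distance h₁ h₂ ≤ (leftWeight E : ℕ∞) := by
  obtain ⟨⟨hker₁, hker₂⟩, hle⟩ := hE.ker_ne_bot_and_le_leftWeight h₁ h₂
  rwa [distance_eq_min h₁ h₂ hker₁ hker₂]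

end Distance

/-! ### Propagation of faults -/

section Propagation

variable {L R : Type}

/-- A time step permutes the left qubits, so it preserves the left weight. -/
theorem leftWeight_conj [Fintype R] (s : Step L R) (E : Pauli (L ⊕ R)) :
    leftWeight (s.conj E) = leftWeight E := by
  have hpre : {l : L | Sum.inl l ∈ (s.conj E).supp} =
      s.permL.symm ⁻¹' {l : L | Sum.inl l ∈ E.supp} := rfl
  rw [leftWeight, hpre, Set.ncard_preimage_of_injective_subset_range (Equiv.injective _) (by simp),
    leftWeight]

theorem leftWeight_add_le [Fintype L] (E E' : Pauli (L ⊕ R)) :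
    leftWeight (E + E') ≤ leftWeight E + leftWeight E' := by
  refine (Set.ncard_le_ncard ?_ (Set.toFinite _)).trans (Set.ncard_union_le _ _)
  intro l hl
  by_contra hnot
  simp only [Pauli.supp, Set.mem_union, Set.mem_ofPred_eq] at hl hnot
  push Not at hnot
  simp [hnot.1.1, hnot.1.2, hnot.2.1, hnot.2.2] at hl

theorem leftWeight_foldl_le [Fintype L] [Fintype R] (n : ℕ) (step : Fin n → Step L R)
    (after : Fin n → Pauli (L ⊕ R)) (E₀ : Pauli (L ⊕ R)) :
    leftWeight (Fin.foldl n (fun E i => (step i).conj E + after i) E₀) ≤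
      leftWeight E₀ + ∑ i, leftWeight (after i) := by
  induction n with
  | zero => simp
  | succ n ih =>
    rw [Fin.foldl_succ_last, Fin.sum_univ_castSucc]
    refine (leftWeight_add_le _ _).trans ?_
    rw [leftWeight_conj, ← add_assoc]
    exact Nat.add_le_add_right (ih (fun i => step i.castSucc) fun i => after i.castSucc) _

theorem leftWeight_residual_le [Fintype L] [Fintype R] {C : Circuit L R} (F : C.Faults) :
    leftWeight F.residual ≤ F.count := by
  refine (leftWeight_foldl_le C.depth C.step F.after F.before).trans ?_
  refine add_le_add ?_ (Finset.sum_le_sum fun i _ => Nat.le_add_right _ _)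
  rw [weight_eq_add]
  exact Nat.le_add_right _ _

theorem conj_zero [Fintype R] (s : Step L R) : s.conj 0 = 0 := by
  have hact : s.act (fun _ => 0, fun _ => 0) = 0 := map_zero s.act
  have h : s.conj 0 = (Sum.elim (fun _ => 0) (s.act (fun _ => 0, fun _ => 0)).1,
    Sum.elim (fun _ => 0) (s.act (fun _ => 0, fun _ => 0)).2) := rfl
  rw [h, hact]
  ext q <;> rcases q with q | q <;> rfl

theorem foldl_conj_zero [Fintype R] (n : ℕ) (step : Fin n → Step L R) :
    Fin.foldl n (fun E i => (step i).conj E + 0) (0 : Pauli (L ⊕ R)) = 0 := by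
  induction n with
  | zero => simp
  | succ n ih =>
    rw [Fin.foldl_succ_last, ih fun i => step i.castSucc, conj_zero, add_zero]

theorem faultCount_zero [Fintype R] (s : Step L R) : s.faultCount 0 = 0 := by
  simp [Step.faultCount, Pauli.supp]

theorem faultCount_le_weight [Fintype L] [Fintype R] (s : Step L R) (E : Pauli (L ⊕ R)) :
    s.faultCount E ≤ E.weight := by
  rw [weight_eq_add]
  exact Nat.add_le_add_left (Set.ncard_image_le (Set.toFinite _)) _

/-- Faults at the last locations of a circuit produce any given residual error. -/
theorem exists_faults_residual_eq [Fintype L] [Fintype R] (C : Circuit L R) (E : Pauli (L ⊕ R)) :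
    ∃ F : C.Faults, F.residual = E ∧ F.count ≤ E.weight := by
  obtain ⟨n, step⟩ := C
  cases n with
  | zero => exact ⟨⟨E, fun i => i.elim0⟩, by simp [Circuit.Faults.residual],
      by simp [Circuit.Faults.count]⟩
  | succ n =>
    -- faults only after the last step: the error `E` is not propagated any further
    refine ⟨⟨0, Fin.lastCases E fun _ => 0⟩, ?_, ?_⟩
    · simp only [Circuit.Faults.residual, Fin.foldl_succ_last, Fin.lastCases_castSucc,
        Fin.lastCases_last]
      rw [foldl_conj_zero n fun i => step i.castSucc, conj_zero, zero_add]
    · have hbefore : Pauli.weight (0 : Pauli (L ⊕ R)) = 0 := by simp [Pauli.weight, Pauli.supp]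
      simp only [Circuit.Faults.count, Fin.sum_univ_castSucc, Fin.lastCases_castSucc,
        Fin.lastCases_last, faultCount_zero, hbefore, Finset.sum_const_zero, zero_add]
      exact faultCount_le_weight _ E

end Propagation

/-! ### The effective fault distance -/

section FaultDistance

variable {m₁ n₁ m₂ n₂ : ℕ}
variable (h₁ : Matrix (Fin m₁) (Fin n₁) (ZMod 2)) (h₂ : Matrix (Fin m₂) (Fin n₂) (ZMod 2))

theorem distance_le_count {C : Circuit (LeftQ n₁ n₂) (RightQ m₁ m₂)} (F : C.Faults)
    (hF : IsLogical h₁ h₂ F.residual) : distance h₁ h₂ ≤ (F.count : ℕ∞) :=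
  (hF.distance_le_leftWeight h₁ h₂).trans (by exact_mod_cast leftWeight_residual_le F)

theorem effectiveFaultDistance_eq_distance (C : Circuit (LeftQ n₁ n₂) (RightQ m₁ m₂)) :
    effectiveFaultDistance h₁ h₂ C = distance h₁ h₂ := by
  refine le_antisymm (le_iInf₂ fun E hE => ?_) (le_iInf₂ fun F hF => distance_le_count h₁ h₂ F hF)
  obtain ⟨F, rfl, hcount⟩ := exists_faults_residual_eq C E
  exact (iInf₂_le F hE).trans (by exact_mod_cast hcount)

end FaultDistance

end LeftHGP

theorem mainTheorem6 {m₁ n₁ m₂ n₂ : ℕ}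
    (h₁ : Matrix (Fin m₁) (Fin n₁) (ZMod 2)) (h₂ : Matrix (Fin m₂) (Fin n₂) (ZMod 2)) :
    (LinearMap.ker h₁.mulVecLin ≠ ⊥ → LinearMap.ker h₂.mulVecLin ≠ ⊥ →
      LeftHGP.distance h₁ h₂ = min (LeftHGP.minDist h₁) (LeftHGP.minDist h₂)) ∧
    (∀ (σ₁ : Equiv.Perm (Fin n₁)) (w₁ : Matrix.GeneralLinearGroup (Fin m₁) (ZMod 2)),
      h₁ * σ₁.permMatrix (ZMod 2) = (w₁ : Matrix (Fin m₁) (Fin m₁) (ZMod 2)) * h₁ →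
      ∀ C : LeftHGP.Circuit (LeftHGP.LeftQ n₁ n₂) (LeftHGP.RightQ m₁ m₂),
        C.Implements (LeftHGP.gadget₁ m₂ n₂ σ₁ w₁) →
        LeftHGP.effectiveFaultDistance h₁ h₂ C = LeftHGP.distance h₁ h₂ ∧
        ∀ F : C.Faults, LeftHGP.IsLogical h₁ h₂ F.residual →
          LeftHGP.distance h₁ h₂ ≤ (F.count : ℕ∞)) ∧
    (∀ (σ₂ : Equiv.Perm (Fin n₂)) (w₂ : Matrix.GeneralLinearGroup (Fin m₂) (ZMod 2)),
      h₂ * σ₂.permMatrix (ZMod 2) = (w₂ : Matrix (Fin m₂) (Fin m₂) (ZMod 2)) * h₂ →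
      ∀ C : LeftHGP.Circuit (LeftHGP.LeftQ n₁ n₂) (LeftHGP.RightQ m₁ m₂),
        C.Implements (LeftHGP.gadget₂ m₁ n₁ σ₂ w₂) →
        LeftHGP.effectiveFaultDistance h₁ h₂ C = LeftHGP.distance h₁ h₂ ∧
        ∀ F : C.Faults, LeftHGP.IsLogical h₁ h₂ F.residual →
          LeftHGP.distance h₁ h₂ ≤ (F.count : ℕ∞)) := by
  exact ⟨LeftHGP.distance_eq_min h₁ h₂,
    fun _ _ _ C _ => ⟨LeftHGP.effectiveFaultDistance_eq_distance h₁ h₂ C,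
      LeftHGP.distance_le_count h₁ h₂⟩,
    fun _ _ _ C _ => ⟨LeftHGP.effectiveFaultDistance_eq_distance h₁ h₂ C,
      LeftHGP.distance_le_count h₁ h₂⟩⟩
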